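/- Let $d\ge 2$ be an integer. Points $q_1,\dots,q_n\in\mathbb{R}^d$ are in general position if they are affinely independent, and in good position if moreover $|q_1-q_i|=|q_2-q_i|=\dots=|q_{i-1}-q_i|$ for $3\le i\le n$. A $d$-dimensional iterated circumcenter sequence (ICS) is a sequence $p=(p_i)_{i\ge 1}$ of points in $\mathbb{R}^d$ such that for every $i\ge 1$ the points $p_i,p_{i+1},\dots,p_{i+d}$ are in general position and $p_{i+d+1}$ is the center of the unique sphere in $\mathbb{R}^d$ through them. It is special if $p_1,\dots,p_{d+1}$ are in good position, and periodic if there is an integer $m>0$ with $p_{i+m}=p_i$ for all $i\ge 1$. The scale factor of a special ICS $p$ is $$\frac{1}{2^{d+2}\sqrt{a_1a_2\cdots a_{d+2}}},\qquad\text{where } a_i=\frac{|p_i-p_{i+1}|^2}{4\,|p_{i+1}-p_{i+2}|^2}.$$ Then for every real number $r\in[\cos^{d+2}(\pi/(d+2)),\infty)$ there is a special $d$-dimensional ICS with scale factor $r$. In particular, there exists a periodic $d$-dimensional ICS. -/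

import Mathlib

/-- Points `q 0, …, q (n - 1)` of `ℝ^d` are in good position if they are in general position
(affinely independent) and every point is equidistant from all the points before it. -/
structure InGoodPosition {d n : ℕ} (q : Fin n → EuclideanSpace ℝ (Fin d)) : Prop where
  affineIndependent : AffineIndependent ℝ q
  dist_eq : ∀ i j k : Fin n, j < i → k < i → dist (q j) (q i) = dist (q k) (q i)

/-- A `d`-dimensional iterated circumcenter sequence, indexed from `0`: any `d + 1` consecutive
points are in general position, and the next point is the center of the sphere through them. -/
def IsICS (d : ℕ) (p : ℕ → EuclideanSpace ℝ (Fin d)) : Prop :=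
  ∀ i : ℕ, ∃ h : AffineIndependent ℝ (fun j : Fin (d + 1) => p (i + (j : ℕ))),
    p (i + d + 1) =
      (⟨fun j : Fin (d + 1) => p (i + (j : ℕ)), h⟩ :
        Affine.Simplex ℝ (EuclideanSpace ℝ (Fin d)) d).circumcenter

/-- An ICS is special if its first `d + 1` points are in good position. -/
def IsSpecialICS (d : ℕ) (p : ℕ → EuclideanSpace ℝ (Fin d)) : Prop :=
  IsICS d p ∧ InGoodPosition (fun j : Fin (d + 1) => p (j : ℕ))

/-- A sequence is periodic if it is invariant under the shift by some `m > 0`. -/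
def IsPeriodicSeq {d : ℕ} (p : ℕ → EuclideanSpace ℝ (Fin d)) : Prop :=
  ∃ m : ℕ, 0 < m ∧ ∀ i : ℕ, p i = p (i + m)

/-- The characteristic sequence of `p`. -/
noncomputable def characteristicSeq {d : ℕ} (p : ℕ → EuclideanSpace ℝ (Fin d)) (i : ℕ) : ℝ :=
  dist (p i) (p (i + 1)) ^ 2 / (4 * dist (p (i + 1)) (p (i + 2)) ^ 2)

/-- The scale factor of `p`, from the first `d + 2` terms of its characteristic sequence. -/
noncomputable def scaleFactor (d : ℕ) (p : ℕ → EuclideanSpace ℝ (Fin d)) : ℝ :=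
  1 / (2 ^ (d + 2) * Real.sqrt (∏ i ∈ Finset.range (d + 2), characteristicSeq p i))

/-!
The edges `e k = p (k + 1) - p k` of a special ICS satisfy `⟪e k, e (k + 1)⟫ = -‖e k‖ ^ 2 / 2` and
are orthogonal to the `d - 1` edges after the next one; conversely, these relations together with
the spanning of `ℝ^d` by any `d` consecutive edges give a special ICS.

Up to positive factors, the solutions come from the directions `θ 0 < θ 1 < ⋯` of `d + 2` lines in a
plane, continued by `θ (k + (d + 2)) = θ k + π`: the Gram matrix of any `d + 1` consecutive rescaled
edges is tridiagonal, and its kernel is spanned by the sines `sin (θ (k + a + 1) - θ k)` because of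
the three-term relation of the sine. So the edges continue by a linear recurrence, which turns out
to be antiperiodic with period `d + 2`. Undoing the rescaling, a shift by `d + 2` multiplies every
edge by `-ρ`, where `ρ = ∏ sin (θ (i + 2) - θ i) / (2 sin (θ (i + 1) - θ i))`, and `ρ` is the scale
factor.

If all gaps but one are equal to `y`, then `ρ` is `cos (π / (d + 2)) ^ (d + 2)` for
`y = π / (d + 2)` and tends to infinity as `y` increases to `π / (d + 1)`, so the intermediate value
theorem yields every value in between. For `ρ = 1`, the edges are antiperiodic and the sequence has
period `2 (d + 2)`.
-/

open Finset Submodule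

section LinearAlgebra

variable {K V : Type*} [DivisionRing K] [AddCommGroup V] [Module K V] {d : ℕ}

/-- The sequence that starts with `b 0, …, b (d - 1)` and continues by the linear recurrence
`∑ a ≤ d, c k a • E (k + a) = 0`, solved for its last term. -/
def recurrenceSeq (d : ℕ) (c : ℕ → ℕ → K) (b : ℕ → V) : ℕ → V
  | m => if m < d then b m else
      -(c (m - d) d)⁻¹ • ∑ a : Fin d, c (m - d) a • recurrenceSeq d c b (m - d + a)
  decreasing_by omega

theorem exists_eq_of_lt_and_sum_smul_eq_zero {c : ℕ → ℕ → K} (hc : ∀ k, c k d ≠ 0) (b : ℕ → V) :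
    ∃ E : ℕ → V, (∀ m < d, E m = b m) ∧ ∀ k, ∑ a ∈ range (d + 1), c k a • E (k + a) = 0 := by
  refine ⟨recurrenceSeq d c b, fun m hm => by rw [recurrenceSeq, if_pos hm], fun k => ?_⟩
  rw [sum_range_succ, recurrenceSeq.eq_def d c b (k + d), if_neg (by omega), Nat.add_sub_cancel,
    smul_smul, mul_neg, mul_inv_cancel₀ (hc k), neg_one_smul,
    Fin.sum_univ_eq_sum_range (fun a => c k a • recurrenceSeq d c b (k + a)), add_neg_cancel]

theorem span_image_Ico_succ_eq_top {c : ℕ → K} {E : ℕ → V} {k : ℕ}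
    (hrel : ∑ a ∈ range (d + 1), c a • E (k + a) = 0) (hc : c 0 ≠ 0)
    (hspan : span K (E '' Set.Ico k (k + d)) = ⊤) :
    span K (E '' Set.Ico (k + 1) (k + 1 + d)) = ⊤ := by
  have hmem : ∀ m ∈ Set.Ico (k + 1) (k + 1 + d), E m ∈ span K (E '' Set.Ico (k + 1) (k + 1 + d)) :=
    fun m hm => subset_span (Set.mem_image_of_mem E hm)
  rw [eq_top_iff, ← hspan, span_le]
  rintro _ ⟨m, ⟨hkm, hmd⟩, rfl⟩
  rcases hkm.eq_or_lt with rfl | hkm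
  · rw [sum_range_succ', add_zero] at hrel
    refine (smul_mem_iff _ hc).1 ?_
    rw [eq_neg_of_add_eq_zero_right hrel]
    refine neg_mem (sum_mem fun a ha => smul_mem _ _ (hmem _ ?_))
    grind
  · exact hmem m ⟨hkm, by omega⟩

end LinearAlgebra

theorem periodic_two_mul_of_antiperiodic_sub {G : Type*} [AddCommGroup G] {p : ℕ → G} {n : ℕ}
    (hp : Function.Antiperiodic (fun k => p (k + 1) - p k) n) : Function.Periodic p (2 * n) := by
  have hconst (k : ℕ) : p (k + n) + p k = p n + p 0 := by
    induction k with
    | zero => rw [zero_add]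
    | succ k ih =>
      have hk : p (k + n + 1) - p (k + n) = -(p (k + 1) - p k) := hp k
      rw [← ih, add_right_comm, eq_add_of_sub_eq hk]
      abel
  intro k
  have hshift := (hconst (k + n)).trans (hconst k).symm
  rw [add_comm (p (k + n))] at hshift
  rw [two_mul, ← add_assoc, add_right_cancel hshift]

section InnerProduct

variable {V : Type*} [NormedAddCommGroup V] [InnerProductSpace ℝ V] {d : ℕ}

open scoped RealInnerProductSpace

theorem eq_zero_of_span_eq_top_of_inner_eq_zero {s : Set V} (hs : span ℝ s = ⊤) {v : V}
    (hv : ∀ w ∈ s, ⟪v, w⟫ = 0) : v = 0 := by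
  have hzero : innerₛₗ ℝ v = 0 := LinearMap.ext_on hs hv
  exact inner_self_eq_zero.1 (LinearMap.congr_fun hzero v)

theorem inner_eq_of_sum_smul_eq_zero {c : ℕ → ℝ} {E : ℕ → V} {G : ℕ → ℕ → ℝ}
    (hsymm : ∀ i j, G i j = G j i) (hE : ∑ a ∈ range (d + 1), c a • E a = 0)
    (hG : ∀ j ≤ d, ∑ a ∈ range (d + 1), c a * G a j = 0) (hc : c d ≠ 0)
    (h : ∀ i < d, ∀ j < d, ⟪E i, E j⟫ = G i j) :
    ∀ i ≤ d, ∀ j ≤ d, ⟪E i, E j⟫ = G i j := by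
  have hlast_of_forall_lt {j : ℕ} (hj : j ≤ d) (hlt : ∀ a < d, ⟪E a, E j⟫ = G a j) :
      ⟪E d, E j⟫ = G d j := by
    have hinner : ∑ a ∈ range (d + 1), c a * ⟪E a, E j⟫ = 0 := by
      simpa only [sum_inner, real_inner_smul_left, inner_zero_left] using congrArg (⟪·, E j⟫) hE
    have hrow := hinner.trans (hG j hj).symm
    rw [sum_range_succ, sum_range_succ,
      sum_congr rfl fun a ha => by rw [hlt a (mem_range.1 ha)]] at hrow
    exact mul_left_cancel₀ hc (add_left_cancel hrow)
  have hlast : ∀ j < d, ⟪E d, E j⟫ = G d j := fun j hj =>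
    hlast_of_forall_lt hj.le fun a ha => h a ha j hj
  have hcol : ∀ a < d, ⟪E a, E d⟫ = G a d := fun a ha => by
    rw [real_inner_comm, hsymm, hlast a ha]
  intro i hi j hj
  rcases hi.eq_or_lt with rfl | hi <;> rcases hj.eq_or_lt with rfl | hj
  · exact hlast_of_forall_lt le_rfl hcol
  · exact hlast j hj
  · exact hcol i hi
  · exact h i hi j hj

theorem inner_window_eq_of_sum_smul_eq_zero {c : ℕ → ℕ → ℝ} {E : ℕ → V} {G : ℕ → ℕ → ℝ}
    (hsymm : ∀ i j, G i j = G j i) (hE : ∀ k, ∑ a ∈ range (d + 1), c k a • E (k + a) = 0)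
    (hG : ∀ k, ∀ j ≤ d, ∑ a ∈ range (d + 1), c k a * G (k + a) (k + j) = 0)
    (hc : ∀ k, c k d ≠ 0) (h : ∀ i < d, ∀ j < d, ⟪E i, E j⟫ = G i j) (k : ℕ) :
    ∀ i ≤ d, ∀ j ≤ d, ⟪E (k + i), E (k + j)⟫ = G (k + i) (k + j) := by
  have hextend (k : ℕ) (hk : ∀ i < d, ∀ j < d, ⟪E (k + i), E (k + j)⟫ = G (k + i) (k + j)) :
      ∀ i ≤ d, ∀ j ≤ d, ⟪E (k + i), E (k + j)⟫ = G (k + i) (k + j) :=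
    inner_eq_of_sum_smul_eq_zero (fun i j => hsymm (k + i) (k + j)) (hE k) (hG k) (hc k) hk
  refine hextend k ?_
  induction k with
  | zero => simpa only [zero_add] using h
  | succ k ih =>
    intro i hi j hj
    rw [Nat.succ_add_eq_add_succ, Nat.succ_add_eq_add_succ]
    exact hextend k ih (i + 1) hi (j + 1) hj

theorem exists_orthogonal_family (b : OrthonormalBasis (Fin d) ℝ V) {c : ℕ → ℝ}
    (hpos : ∀ m < d, 0 < c m) (hc : c d = 0) :
    ∃ g : ℕ → V, g d = 0 ∧ (∀ i ≤ d, ∀ j ≤ d, ⟪g i, g j⟫ = if i = j then c i else 0) ∧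
      span ℝ (g '' Set.Iio d) = ⊤ := by
  let g : ℕ → V := fun m => if hm : m < d then √(c m) • b ⟨m, hm⟩ else 0
  have hg {m : ℕ} (hm : m < d) : g m = √(c m) • b ⟨m, hm⟩ := dif_pos hm
  have hgd : g d = 0 := dif_neg (lt_irrefl d)
  refine ⟨g, hgd, fun i hi j hj => ?_, ?_⟩
  · rcases hi.eq_or_lt with rfl | hi
    · rw [hgd, inner_zero_left, hc, ite_self]
    rcases hj.eq_or_lt with rfl | hj
    · rw [hgd, inner_zero_right, if_neg hi.ne]
    rw [hg hi, hg hj, real_inner_smul_left, real_inner_smul_right, b.inner_eq_ite]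
    rcases eq_or_ne i j with rfl | hij
    · rw [if_pos rfl, if_pos rfl, mul_one, Real.mul_self_sqrt (hpos i hi).le]
    · rw [if_neg (by simpa using hij), if_neg hij, mul_zero, mul_zero]
  · rw [eq_top_iff, ← b.toBasis.span_eq, span_le]
    rintro _ ⟨⟨m, hm⟩, rfl⟩
    have hsqrt : √(c m) ≠ 0 := (Real.sqrt_pos.2 (hpos m hm)).ne'
    have hmem : g m ∈ span ℝ (g '' Set.Iio d) := subset_span ⟨m, hm, rfl⟩
    rw [hg hm, smul_mem_iff _ hsqrt] at hmem
    simpa using hmem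

end InnerProduct

section Angles

/-- The sine of the angle from `θ i` to `θ j`. -/
noncomputable def gapSin (θ : ℕ → ℝ) (i j : ℕ) : ℝ := Real.sin (θ j - θ i)

/-- The directions of `n` distinct lines through a point in cyclic order, continued through all
further half turns. -/
structure IsCyclicAngleSeq (n : ℕ) (θ : ℕ → ℝ) : Prop where
  strictMono : StrictMono θ
  add_period : ∀ j, θ (j + n) = θ j + Real.pi

variable {θ : ℕ → ℝ} {n : ℕ}

@[simp]
theorem gapSin_self (θ : ℕ → ℝ) (i : ℕ) : gapSin θ i i = 0 := by
  rw [gapSin, sub_self, Real.sin_zero]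

theorem gapSin_comm (θ : ℕ → ℝ) (i j : ℕ) : gapSin θ i j = -gapSin θ j i := by
  rw [gapSin, gapSin, ← Real.sin_neg, neg_sub]

theorem gapSin_three_term (θ : ℕ → ℝ) (k a b c : ℕ) :
    gapSin θ a c * gapSin θ k b = gapSin θ a b * gapSin θ k c + gapSin θ b c * gapSin θ k a := by
  simp only [gapSin, Real.sin_sub]
  ring

namespace IsCyclicAngleSeq

theorem gapSin_pos (hθ : IsCyclicAngleSeq n θ) {i j : ℕ} (hij : i < j) (hji : j < i + n) :
    0 < gapSin θ i j := by
  have hlt := hθ.strictMono hij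
  have hlt_pi := hθ.strictMono hji
  rw [hθ.add_period] at hlt_pi
  exact Real.sin_pos_of_pos_of_lt_pi (by linarith) (by linarith)

theorem gapSin_add_right (hθ : IsCyclicAngleSeq n θ) (i j : ℕ) :
    gapSin θ i (j + n) = -gapSin θ i j := by
  rw [gapSin, hθ.add_period, add_sub_right_comm, Real.sin_add_pi, gapSin]

theorem gapSin_add_add (hθ : IsCyclicAngleSeq n θ) (i j : ℕ) :
    gapSin θ (i + n) (j + n) = gapSin θ i j := by
  rw [gapSin_add_right hθ, gapSin_comm, gapSin_add_right hθ, neg_neg, ← gapSin_comm]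

end IsCyclicAngleSeq

/-- The tridiagonal matrix of the prescribed inner products of edge directions. -/
noncomputable def edgeGram (θ : ℕ → ℝ) (i j : ℕ) : ℝ :=
  if i = j then gapSin θ i (i + 2) / (gapSin θ i (i + 1) * gapSin θ (i + 1) (i + 2))
  else if i + 1 = j then -(gapSin θ j (j + 1))⁻¹
  else if j + 1 = i then -(gapSin θ i (i + 1))⁻¹
  else 0

theorem edgeGram_self (θ : ℕ → ℝ) (i : ℕ) :
    edgeGram θ i i = gapSin θ i (i + 2) / (gapSin θ i (i + 1) * gapSin θ (i + 1) (i + 2)) :=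
  if_pos rfl

theorem edgeGram_succ_right (θ : ℕ → ℝ) (i : ℕ) :
    edgeGram θ i (i + 1) = -(gapSin θ (i + 1) (i + 2))⁻¹ := by
  simp [edgeGram]

theorem edgeGram_comm (θ : ℕ → ℝ) (i j : ℕ) : edgeGram θ i j = edgeGram θ j i := by
  unfold edgeGram
  grind

theorem edgeGram_of_add_one_lt (θ : ℕ → ℝ) {i j : ℕ} (h : i + 1 < j) : edgeGram θ i j = 0 := by
  grind [edgeGram]

namespace IsCyclicAngleSeq

variable {d : ℕ}

theorem gapSin_mul_edgeGram_self (hθ : IsCyclicAngleSeq (d + 2) θ) (k i : ℕ) :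
    gapSin θ k (i + 1) * edgeGram θ i i =
      gapSin θ k i / gapSin θ i (i + 1) + gapSin θ k (i + 2) / gapSin θ (i + 1) (i + 2) := by
  have hi : gapSin θ i (i + 1) ≠ 0 := (hθ.gapSin_pos (by omega) (by omega)).ne'
  have hi' : gapSin θ (i + 1) (i + 2) ≠ 0 := (hθ.gapSin_pos (by omega) (by omega)).ne'
  rw [edgeGram_self]
  field_simp
  linarith [gapSin_three_term θ k i (i + 1) (i + 2)]

theorem edgeGram_self_pos (hd : 0 < d) (hθ : IsCyclicAngleSeq (d + 2) θ) (i : ℕ) :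
    0 < edgeGram θ i i := by
  rw [edgeGram_self]
  exact div_pos (hθ.gapSin_pos (by omega) (by omega))
    (mul_pos (hθ.gapSin_pos (by omega) (by omega)) (hθ.gapSin_pos (by omega) (by omega)))

/-- The rows of `edgeGram` reproduce the three-term relation of the sines, and no boundary terms
remain because `sin (θ k - θ k) = sin (θ (k + d + 2) - θ k) = 0`. -/
theorem sum_gapSin_mul_edgeGram (hθ : IsCyclicAngleSeq (d + 2) θ) (k : ℕ) {j : ℕ} (hj : j ≤ d) :
    ∑ a ∈ range (d + 1), gapSin θ k (k + a + 1) * edgeGram θ (k + a) (k + j) = 0 := by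
  set L := gapSin θ k (k + j) / gapSin θ (k + j) (k + j + 1) with hL
  set R := gapSin θ k (k + j + 2) / gapSin θ (k + j + 1) (k + j + 2) with hR
  have hterm : ∀ a, gapSin θ k (k + a + 1) * edgeGram θ (k + a) (k + j) =
      (if a = j then L + R else 0) - (if a + 1 = j then L else 0) -
        (if a = j + 1 then R else 0) := by
    intro a
    rcases eq_or_ne a j with rfl | hdiag
    · simp [hθ.gapSin_mul_edgeGram_self, hL, hR]
    · grind [edgeGram]
  have hleft : ∑ a ∈ range (d + 1), (if a + 1 = j then L else 0) = L := by
    rcases j with _ | j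
    · simp [hL]
    · simp [show j < d + 1 by omega]
  have hright : ∑ a ∈ range (d + 1), (if a = j + 1 then R else 0) = R := by
    rcases hj.eq_or_lt with rfl | hj
    · simp [hR, add_assoc, hθ.gapSin_add_right]
    · simp [hj]
  simp only [hterm, sum_sub_distrib, sum_ite_eq', mem_range, Nat.lt_succ_of_le hj, if_true, hleft,
    hright]
  ring

end IsCyclicAngleSeq

end Angles

section EdgeFrame

open scoped RealInnerProductSpace

variable {V : Type*} [NormedAddCommGroup V] [InnerProductSpace ℝ V] {d : ℕ} {θ : ℕ → ℝ}
  {E : ℕ → V}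

/-- A sequence of vectors whose windows of length `d + 1` have Gram matrix `edgeGram θ` and whose
windows of length `d` span: the edges of a special ICS up to positive factors. -/
structure IsEdgeFrame (d : ℕ) (θ : ℕ → ℝ) (E : ℕ → V) : Prop where
  inner_eq : ∀ i j, i ≤ j → j ≤ i + d → ⟪E i, E j⟫ = edgeGram θ i j
  span_eq_top : ∀ k, span ℝ (E '' Set.Ico k (k + d)) = ⊤

namespace IsEdgeFrame

theorem inner_eq_of_le (hE : IsEdgeFrame d θ E) (k : ℕ) {i j : ℕ} (hi : i ≤ d) (hj : j ≤ d) :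
    ⟪E (k + i), E (k + j)⟫ = edgeGram θ (k + i) (k + j) := by
  rcases le_total i j with hij | hij
  · exact hE.inner_eq _ _ (by omega) (by omega)
  · rw [real_inner_comm, edgeGram_comm, hE.inner_eq _ _ (by omega) (by omega)]

theorem norm_sq_eq (hE : IsEdgeFrame d θ E) (k : ℕ) : ‖E k‖ ^ 2 = edgeGram θ k k := by
  rw [← real_inner_self_eq_norm_sq, hE.inner_eq k k le_rfl (by omega)]

theorem ne_zero (hd : 0 < d) (hθ : IsCyclicAngleSeq (d + 2) θ) (hE : IsEdgeFrame d θ E) (k : ℕ) :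
    E k ≠ 0 := fun h => by
  have hpos := hθ.edgeGram_self_pos hd k
  simp [← hE.norm_sq_eq, h] at hpos

theorem sum_gapSin_smul (hθ : IsCyclicAngleSeq (d + 2) θ) (hE : IsEdgeFrame d θ E) (k : ℕ) :
    ∑ a ∈ range (d + 1), gapSin θ k (k + a + 1) • E (k + a) = 0 := by
  refine eq_zero_of_span_eq_top_of_inner_eq_zero (hE.span_eq_top k) ?_
  rintro _ ⟨m, ⟨hkm, hmd⟩, rfl⟩
  obtain ⟨j, rfl⟩ := Nat.exists_eq_add_of_le hkm
  rw [sum_inner, ← hθ.sum_gapSin_mul_edgeGram k (show j ≤ d by omega)]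
  refine sum_congr rfl fun a ha => ?_
  rw [real_inner_smul_left, hE.inner_eq_of_le k (mem_range_succ_iff.1 ha) (by omega)]

theorem inner_add_succ (hd : 0 < d) (hθ : IsCyclicAngleSeq (d + 2) θ) (hE : IsEdgeFrame d θ E)
    (k : ℕ) : ⟪E k, E (k + (d + 1))⟫ = (gapSin θ k (k + 1))⁻¹ := by
  have hfirst : gapSin θ (k + 1) (k + 2) ≠ 0 := (hθ.gapSin_pos (by omega) (by omega)).ne'
  have hlast : gapSin θ (k + 1) (k + (d + 2)) = gapSin θ k (k + 1) := by
    rw [hθ.gapSin_add_right, ← gapSin_comm]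
  have hmid : ∑ a ∈ range d, gapSin θ (k + 1) (k + 1 + a + 1) * ⟪E k, E (k + 1 + a)⟫ = -1 := by
    rw [sum_eq_single_of_mem 0 (mem_range.2 hd)]
    · rw [add_zero, hE.inner_eq k (k + 1) (by omega) (by omega), edgeGram_succ_right, mul_neg,
        mul_inv_cancel₀ hfirst]
    · intro a ha ha0
      have had := mem_range.1 ha
      rw [hE.inner_eq _ _ (by omega) (by omega), edgeGram_of_add_one_lt θ (by omega), mul_zero]
  have hrel : ∑ a ∈ range (d + 1), gapSin θ (k + 1) (k + 1 + a + 1) * ⟪E k, E (k + 1 + a)⟫ = 0 := by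
    simpa only [inner_sum, real_inner_smul_right, inner_zero_right] using
      congrArg (⟪E k, ·⟫) (hE.sum_gapSin_smul hθ (k + 1))
  rw [sum_range_succ, hmid, show k + 1 + d + 1 = k + (d + 2) by omega, hlast,
    show k + 1 + d = k + (d + 1) by omega] at hrel
  exact eq_inv_of_mul_eq_one_right (by linarith)

theorem antiperiodic (hd : 0 < d) (hθ : IsCyclicAngleSeq (d + 2) θ) (hE : IsEdgeFrame d θ E) :
    Function.Antiperiodic E (d + 2) := by
  intro k
  rw [← add_eq_zero_iff_eq_neg]
  refine eq_zero_of_span_eq_top_of_inner_eq_zero (hE.span_eq_top (k + 2)) ?_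
  rintro _ ⟨j, ⟨hkj, hjd⟩, rfl⟩
  rw [inner_add_left, real_inner_comm, hE.inner_eq j _ (by omega) (by omega)]
  rcases (show j ≤ k + (d + 1) by omega).eq_or_lt with rfl | hj
  · have hgram : edgeGram θ (k + (d + 1)) (k + (d + 2)) = -(gapSin θ k (k + 1))⁻¹ := by
      rw [← hθ.gapSin_add_add k (k + 1), add_right_comm k 1 (d + 2)]
      exact edgeGram_succ_right θ (k + (d + 1))
    rw [hE.inner_add_succ hd hθ, hgram, neg_add_cancel]
  · rw [edgeGram_of_add_one_lt θ (by omega), hE.inner_eq k j (by omega) (by omega),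
      edgeGram_of_add_one_lt θ (by omega), add_zero]

end IsEdgeFrame

/-- The bidiagonal factorization of the tridiagonal matrix `edgeGram`; its coefficients form the
null vector of the three-term relation that vanishes at index `d + 1`. -/
theorem inner_scaled_sub_eq_edgeGram (hθ : IsCyclicAngleSeq (d + 2) θ) {g : ℕ → V}
    (hg : ∀ i ≤ d, ∀ j ≤ d, ⟪g i, g j⟫ =
      if i = j then gapSin θ (d + 1) i * gapSin θ (d + 1) (i + 1) / gapSin θ i (i + 1) else 0)
    {i j : ℕ} (hij : i ≤ j) (hj : j < d) :
    ⟪(gapSin θ (d + 1) (i + 1))⁻¹ • (g i - g (i + 1)),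
      (gapSin θ (d + 1) (j + 1))⁻¹ • (g j - g (j + 1))⟫ = edgeGram θ i j := by
  have hne {m : ℕ} (hm : m < d) : gapSin θ (d + 1) (m + 1) ≠ 0 := by
    rw [gapSin_comm, neg_ne_zero]
    exact (hθ.gapSin_pos (by omega) (by omega)).ne'
  have hi := hne (hij.trans_lt hj)
  rw [real_inner_smul_left, real_inner_smul_right, inner_sub_left, inner_sub_right,
    inner_sub_right, hg i (by omega) j hj.le, hg i (by omega) (j + 1) hj,
    hg (i + 1) (by omega) j hj.le, hg (i + 1) (by omega) (j + 1) hj]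
  rcases hij.eq_or_lt with rfl | hlt
  · have hself := hθ.gapSin_mul_edgeGram_self (d + 1) i
    rw [← mul_right_inj' hi, hself]
    simp only [if_true, Nat.succ_ne_self, if_false, Nat.ne_add_one]
    field_simp
    ring
  rcases (show i + 1 ≤ j from hlt).eq_or_lt with rfl | hlt
  · have hj' := hne hj
    have hs : gapSin θ (i + 1) (i + 2) ≠ 0 := (hθ.gapSin_pos (by omega) (by omega)).ne'
    rw [edgeGram_succ_right, if_neg (by omega), if_neg (by omega), if_pos rfl, if_neg (by omega)]
    field_simp
    ring
  · rw [edgeGram_of_add_one_lt θ hlt]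
    grind

theorem span_scaled_sub_eq_top {w : ℕ → ℝ} (hw : ∀ m < d, w m ≠ 0) {g : ℕ → V} (hgd : g d = 0)
    (hspan : span ℝ (g '' Set.Iio d) = ⊤) :
    span ℝ ((fun m => w m • (g m - g (m + 1))) '' Set.Iio d) = ⊤ := by
  set b : ℕ → V := fun m => w m • (g m - g (m + 1))
  have hmem : ∀ m ≤ d, g m ∈ span ℝ (b '' Set.Iio d) := by
    intro m hm
    induction hm using Nat.decreasingInduction with
    | self => rw [hgd]; exact zero_mem _
    | of_succ m hm ih =>
      have hb : b m ∈ span ℝ (b '' Set.Iio d) := subset_span ⟨m, hm, rfl⟩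
      simpa using add_mem ((smul_mem_iff _ (hw m hm)).1 hb) ih
  rw [eq_top_iff, ← hspan, span_le]
  rintro _ ⟨m, hm, rfl⟩
  exact hmem m (le_of_lt hm)

theorem exists_initial_edges (hθ : IsCyclicAngleSeq (d + 2) θ)
    (v : OrthonormalBasis (Fin d) ℝ V) :
    ∃ b : ℕ → V, (∀ i < d, ∀ j < d, ⟪b i, b j⟫ = edgeGram θ i j) ∧
      span ℝ (b '' Set.Iio d) = ⊤ := by
  have hneg {m : ℕ} (hm : m ≤ d) : gapSin θ (d + 1) m < 0 := by
    rw [gapSin_comm, neg_lt_zero]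
    exact hθ.gapSin_pos (by omega) (by omega)
  obtain ⟨g, hgd, hg, hspan⟩ := exists_orthogonal_family v
    (c := fun m => gapSin θ (d + 1) m * gapSin θ (d + 1) (m + 1) / gapSin θ m (m + 1))
    (fun m hm => div_pos (mul_pos_of_neg_of_neg (hneg hm.le) (hneg hm))
      (hθ.gapSin_pos (by omega) (by omega)))
    (by simp)
  refine ⟨fun m => (gapSin θ (d + 1) (m + 1))⁻¹ • (g m - g (m + 1)), fun i hi j hj => ?_,
    span_scaled_sub_eq_top (fun m hm => inv_ne_zero (hneg hm).ne) hgd hspan⟩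
  rcases le_total i j with hij | hij
  · exact inner_scaled_sub_eq_edgeGram hθ hg hij hj
  · rw [real_inner_comm, edgeGram_comm]
    exact inner_scaled_sub_eq_edgeGram hθ hg hij hi

theorem exists_isEdgeFrame (hθ : IsCyclicAngleSeq (d + 2) θ) (v : OrthonormalBasis (Fin d) ℝ V) :
    ∃ E : ℕ → V, IsEdgeFrame d θ E := by
  obtain ⟨b, hb, hspan⟩ := exists_initial_edges hθ v
  have hc (k : ℕ) {a : ℕ} (ha : a ≤ d) : gapSin θ k (k + a + 1) ≠ 0 :=
    (hθ.gapSin_pos (by omega) (by omega)).ne'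
  obtain ⟨E, hEb, hrel⟩ : ∃ E : ℕ → V, (∀ m < d, E m = b m) ∧
      ∀ k, ∑ a ∈ range (d + 1), gapSin θ k (k + a + 1) • E (k + a) = 0 :=
    exists_eq_of_lt_and_sum_smul_eq_zero (fun k => hc k le_rfl) b
  refine ⟨E, fun i j hij hji => ?_, fun k => ?_⟩
  · obtain ⟨l, rfl⟩ := Nat.exists_eq_add_of_le hij
    refine inner_window_eq_of_sum_smul_eq_zero (edgeGram_comm θ) hrel
      (fun k j hj => hθ.sum_gapSin_mul_edgeGram k hj) (fun k => hc k le_rfl) (fun i hi j hj => ?_)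
      i 0 (Nat.zero_le d) l (by omega)
    rw [hEb i hi, hEb j hj, hb i hi j hj]
  · induction k with
    | zero =>
      rw [← hspan, zero_add, ← Nat.bot_eq_zero, Set.Ico_bot]
      exact congrArg _ (Set.image_congr fun m hm => hEb m hm)
    | succ k ih =>
      exact span_image_Ico_succ_eq_top (c := fun a => gapSin θ k (k + a + 1)) (hrel k)
        (hc k (a := 0) (Nat.zero_le d)) ih

end EdgeFrame

section Points

open scoped RealInnerProductSpace

variable {V : Type*} [NormedAddCommGroup V] [InnerProductSpace ℝ V] {d : ℕ} {p : ℕ → V}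

/-- The conditions on the edges `p (k + 1) - p k` that make `p` a special ICS in `ℝ^d`. -/
structure HasICSEdges (d : ℕ) (p : ℕ → V) : Prop where
  inner_succ : ∀ k, ⟪p (k + 1) - p k, p (k + 2) - p (k + 1)⟫ = -(‖p (k + 1) - p k‖ ^ 2 / 2)
  inner_eq_zero : ∀ i j, i + 1 < j → j ≤ i + d → ⟪p (i + 1) - p i, p (j + 1) - p j⟫ = 0
  span_eq_top : ∀ k, span ℝ ((fun m => p (m + 1) - p m) '' Set.Ico k (k + d)) = ⊤

namespace HasICSEdges

theorem dist_succ_eq (hp : HasICSEdges d p) {i m : ℕ} (him : i ≤ m) (hmi : m ≤ i + d) :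
    dist (p i) (p (m + 1)) = dist (p m) (p (m + 1)) := by
  induction him using Nat.decreasingInduction with
  | self => rfl
  | of_succ i him ih =>
    have hinner : ⟪p (i + 1) - p i, p (m + 1) - p (i + 1)⟫ = -(‖p (i + 1) - p i‖ ^ 2 / 2) := by
      rw [← hp.inner_succ, ← sub_eq_zero, ← inner_sub_right, sub_sub_sub_cancel_right,
        ← sum_Ico_sub p (show i + 2 ≤ m + 1 by omega), inner_sum]
      refine sum_eq_zero fun j hj => ?_
      have := mem_Ico.1 hj
      exact hp.inner_eq_zero i j (by omega) (by omega)
    rw [← ih (by omega), dist_comm, dist_comm (p (i + 1)), dist_eq_norm, dist_eq_norm,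
      ← sq_eq_sq₀ (norm_nonneg _) (norm_nonneg _), ← sub_add_sub_cancel' (p (i + 1)),
      norm_add_sq_real, hinner]
    ring

theorem vectorSpan_eq_top (hp : HasICSEdges d p) (k : ℕ) :
    vectorSpan ℝ (Set.range fun a : Fin (d + 1) => p (k + a)) = ⊤ := by
  have hmem {m : ℕ} (hkm : k ≤ m) (hmd : m ≤ k + d) :
      p m ∈ Set.range fun a : Fin (d + 1) => p (k + a) :=
    ⟨⟨m - k, by omega⟩, congrArg p (Nat.add_sub_of_le hkm)⟩
  rw [eq_top_iff, ← hp.span_eq_top k, span_le]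
  rintro _ ⟨m, ⟨hkm, hmd⟩, rfl⟩
  exact vsub_mem_vectorSpan ℝ (hmem (by omega) (by omega)) (hmem hkm hmd.le)

theorem isSpecialICS {p : ℕ → EuclideanSpace ℝ (Fin d)} (hp : HasICSEdges d p) :
    IsSpecialICS d p := by
  have hind (k : ℕ) : AffineIndependent ℝ (fun a : Fin (d + 1) => p (k + a)) := by
    rw [affineIndependent_iff_finrank_vectorSpan_eq ℝ _ (Fintype.card_fin (d + 1)),
      hp.vectorSpan_eq_top k, finrank_top, finrank_euclideanSpace_fin]
  have haffine (k : ℕ) : affineSpan ℝ (Set.range fun a : Fin (d + 1) => p (k + a)) = ⊤ :=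
    (AffineSubspace.affineSpan_eq_top_iff_vectorSpan_eq_top_of_nonempty ℝ _ _
      (Set.range_nonempty _)).2 (hp.vectorSpan_eq_top k)
  have hdist {i j : ℕ} (hij : i < j) (hji : j ≤ i + d + 1) :
      dist (p i) (p j) = dist (p (j - 1)) (p j) := by
    obtain ⟨m, rfl⟩ := Nat.exists_eq_add_of_lt hij
    exact hp.dist_succ_eq (by omega) (by omega)
  refine ⟨fun k => ⟨hind k, ?_⟩, ?_, fun i j k hj hk => ?_⟩
  · refine Affine.Simplex.eq_circumcenter_of_dist_eq _ ?_ (r := dist (p (k + d)) (p (k + d + 1)))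
      fun a => hdist (by omega) (by omega)
    exact (haffine k).symm ▸ AffineSubspace.mem_top ℝ _ _
  · simpa only [zero_add] using hind 0
  · exact (hdist (Fin.lt_def.1 hj) (by omega)).trans (hdist (Fin.lt_def.1 hk) (by omega)).symm

end HasICSEdges

end Points

section ScaleFactor

variable {d : ℕ} {p : ℕ → EuclideanSpace ℝ (Fin d)}

theorem prod_characteristicSeq (hp : ∀ k, p k ≠ p (k + 1)) (m : ℕ) :
    ∏ i ∈ range m, characteristicSeq p i =
      dist (p 0) (p 1) ^ 2 / (4 ^ m * dist (p m) (p (m + 1)) ^ 2) := by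
  have hdist (k : ℕ) : dist (p k) (p (k + 1)) ≠ 0 := dist_ne_zero.2 (hp k)
  induction m with
  | zero => simp [hp 0]
  | succ m ih =>
    have := hdist m
    have := hdist (m + 1)
    rw [prod_range_succ, ih, characteristicSeq]
    field_simp
    ring

theorem scaleFactor_eq_div (hp : ∀ k, p k ≠ p (k + 1)) :
    scaleFactor d p = dist (p (d + 2)) (p (d + 3)) / dist (p 0) (p 1) := by
  have hpow : (4 : ℝ) ^ (d + 2) = (2 ^ (d + 2)) ^ 2 := by
    rw [← pow_mul, mul_comm, pow_mul]
    norm_num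
  have hfirst : 0 < dist (p 0) (p 1) := dist_pos.2 (hp 0)
  have hlast : 0 < dist (p (d + 2)) (p (d + 3)) := dist_pos.2 (hp (d + 2))
  rw [scaleFactor, prod_characteristicSeq hp, hpow, ← mul_pow, ← div_pow,
    Real.sqrt_sq (by positivity)]
  field_simp

theorem scaleFactor_eq_of_sub_eq (hp : ∀ k, p k ≠ p (k + 1)) {ρ : ℝ} (hρ : 0 ≤ ρ)
    (h : p (d + 2 + 1) - p (d + 2) = -ρ • (p 1 - p 0)) : scaleFactor d p = ρ := by
  rw [scaleFactor_eq_div hp, dist_comm, dist_eq_norm, h, norm_smul, norm_neg,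
    Real.norm_of_nonneg hρ, dist_comm, dist_eq_norm, mul_div_cancel_right₀]
  exact norm_ne_zero_iff.2 (sub_ne_zero.2 (hp 0).symm)

end ScaleFactor

section Rescaling

open scoped RealInnerProductSpace

variable {V : Type*} [NormedAddCommGroup V] [InnerProductSpace ℝ V] {d : ℕ} {θ : ℕ → ℝ}
  {E : ℕ → V}

/-- The length factors that turn an edge frame for the angles `θ` into the edges of a special
ICS. -/
noncomputable def edgeScale (θ : ℕ → ℝ) (k : ℕ) : ℝ :=
  ∏ i ∈ range k, gapSin θ i (i + 2) / (2 * gapSin θ i (i + 1))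

theorem edgeScale_succ (θ : ℕ → ℝ) (k : ℕ) :
    edgeScale θ (k + 1) = edgeScale θ k * (gapSin θ k (k + 2) / (2 * gapSin θ k (k + 1))) :=
  prod_range_succ _ _

namespace IsCyclicAngleSeq

theorem edgeScale_pos (hd : 0 < d) (hθ : IsCyclicAngleSeq (d + 2) θ) (k : ℕ) :
    0 < edgeScale θ k :=
  prod_pos fun _ _ => div_pos (hθ.gapSin_pos (by omega) (by omega))
    (mul_pos two_pos (hθ.gapSin_pos (by omega) (by omega)))

theorem edgeScale_add {n : ℕ} (hθ : IsCyclicAngleSeq n θ) (k : ℕ) :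
    edgeScale θ (k + n) = edgeScale θ n * edgeScale θ k := by
  rw [edgeScale, add_comm k n, prod_range_add, edgeScale, edgeScale]
  refine congrArg _ (prod_congr rfl fun i _ => ?_)
  rw [add_comm n i, add_right_comm i n 2, add_right_comm i n 1, hθ.gapSin_add_add,
    hθ.gapSin_add_add]

end IsCyclicAngleSeq

namespace IsEdgeFrame

theorem hasICSEdges (hd : 0 < d) (hθ : IsCyclicAngleSeq (d + 2) θ) (hE : IsEdgeFrame d θ E)
    {p : ℕ → V} (hp : ∀ k, p (k + 1) - p k = edgeScale θ k • E k) : HasICSEdges d p where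
  inner_succ k := by
    have hk : gapSin θ k (k + 1) ≠ 0 := (hθ.gapSin_pos (by omega) (by omega)).ne'
    have hk' : gapSin θ (k + 1) (k + 2) ≠ 0 := (hθ.gapSin_pos (by omega) (by omega)).ne'
    rw [hp, hp (k + 1), real_inner_smul_left, real_inner_smul_right,
      hE.inner_eq k (k + 1) (by omega) (by omega), edgeGram_succ_right, norm_smul, mul_pow,
      hE.norm_sq_eq, edgeGram_self, edgeScale_succ, Real.norm_eq_abs, sq_abs]
    field_simp
  inner_eq_zero i j hij hji := by
    rw [hp, hp, real_inner_smul_left, real_inner_smul_right, hE.inner_eq i j (by omega) hji,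
      edgeGram_of_add_one_lt θ hij, mul_zero, mul_zero]
  span_eq_top k := by
    rw [eq_top_iff, ← hE.span_eq_top k, span_le]
    rintro _ ⟨m, hm, rfl⟩
    exact (smul_mem_iff _ (hθ.edgeScale_pos hd m).ne').1 (subset_span ⟨m, hm, hp m⟩)

end IsEdgeFrame

theorem exists_isSpecialICS_of_isCyclicAngleSeq (hd : 0 < d) (hθ : IsCyclicAngleSeq (d + 2) θ) :
    ∃ p : ℕ → EuclideanSpace ℝ (Fin d), IsSpecialICS d p ∧ scaleFactor d p = edgeScale θ (d + 2) ∧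
      ∀ k, p (k + (d + 2) + 1) - p (k + (d + 2)) = -edgeScale θ (d + 2) • (p (k + 1) - p k) := by
  obtain ⟨E, hE⟩ := exists_isEdgeFrame hθ (EuclideanSpace.basisFun (Fin d) ℝ)
  let p : ℕ → EuclideanSpace ℝ (Fin d) := fun k => ∑ j ∈ range k, edgeScale θ j • E j
  have hedge (k : ℕ) : p (k + 1) - p k = edgeScale θ k • E k := sum_range_succ_sub_sum _
  have hshift (k : ℕ) :
      p (k + (d + 2) + 1) - p (k + (d + 2)) = -edgeScale θ (d + 2) • (p (k + 1) - p k) := by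
    rw [hedge, hedge, hE.antiperiodic hd hθ, hθ.edgeScale_add, smul_neg, neg_smul, smul_smul]
  have hne (k : ℕ) : p k ≠ p (k + 1) := by
    rw [ne_comm, ← sub_ne_zero, hedge]
    exact smul_ne_zero (hθ.edgeScale_pos hd k).ne' (hE.ne_zero hd hθ k)
  exact ⟨p, (hE.hasICSEdges hd hθ hedge).isSpecialICS,
    scaleFactor_eq_of_sub_eq hne (hθ.edgeScale_pos hd _).le (by simpa using hshift 0), hshift⟩

end Rescaling

section EqualGaps

/-- The directions of `n` lines of which consecutive ones are at angle `y`, so that the last gap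
before the first half turn is `π - (n - 1) * y`. -/
noncomputable def equalGapAngle (n : ℕ) (y : ℝ) (k : ℕ) : ℝ :=
  k * y + (k / n : ℕ) * (Real.pi - n * y)

theorem equalGapAngle_add {n : ℕ} (hn : 0 < n) (y : ℝ) (k : ℕ) :
    equalGapAngle n y (k + n) = equalGapAngle n y k + Real.pi := by
  rw [equalGapAngle, equalGapAngle, Nat.add_div_right k hn]
  push_cast
  ring

theorem equalGapAngle_succ (n : ℕ) (y : ℝ) (k : ℕ) : equalGapAngle n y (k + 1) =
    equalGapAngle n y k + if n ∣ k + 1 then Real.pi - (n - 1) * y else y := by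
  rw [equalGapAngle, equalGapAngle, Nat.succ_div]
  split_ifs <;> push_cast <;> ring

theorem isCyclicAngleSeq_equalGapAngle {n : ℕ} (hn : 0 < n) {y : ℝ} (hy : 0 < y)
    (hlast : (n - 1) * y < Real.pi) : IsCyclicAngleSeq n (equalGapAngle n y) where
  strictMono := strictMono_nat_of_lt_succ fun k => by
    rw [equalGapAngle_succ]
    split_ifs <;> linarith
  add_period k := equalGapAngle_add hn y k

theorem edgeScale_equalGapAngle {d : ℕ} {y : ℝ}
    (hθ : IsCyclicAngleSeq (d + 2) (equalGapAngle (d + 2) y)) :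
    edgeScale (equalGapAngle (d + 2) y) (d + 2) =
      Real.cos y ^ d * Real.sin (d * y) ^ 2 / (4 * Real.sin ((d + 1) * y) * Real.sin y) := by
  set θ := equalGapAngle (d + 2) y with hθy
  have hgap {i j : ℕ} (l : ℝ) (hi : i < d + 2) (hj : j < d + 2) (hl : (j : ℝ) = i + l) :
      gapSin θ i j = Real.sin (l * y) := by
    rw [gapSin, hθy, equalGapAngle, equalGapAngle, Nat.div_eq_of_lt hj, Nat.div_eq_of_lt hi, hl]
    ring_nf
  have hwrap {i j m : ℕ} (hm : m = j + (d + 2)) (l : ℝ) (hi : i < d + 2) (hj : j < d + 2)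
      (hl : (i : ℝ) = j + l) : gapSin θ i m = Real.sin (l * y) := by
    rw [hm, hθ.gapSin_add_right, ← gapSin_comm, hgap l hj hi hl]
  have hone {i : ℕ} (hi : i ≤ d) : gapSin θ i (i + 1) = Real.sin y := by
    rw [hgap 1 (by omega) (by omega) (by simp), one_mul]
  have hsin : Real.sin y ≠ 0 := hone (Nat.zero_le d) ▸ (hθ.gapSin_pos (by omega) (by omega)).ne'
  have hcos : ∀ i ∈ range d, gapSin θ i (i + 2) / (2 * gapSin θ i (i + 1)) = Real.cos y := by
    intro i hi
    have hid := mem_range.1 hi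
    rw [hone hid.le, hgap 2 (by omega) (by omega) (by simp), Real.sin_two_mul]
    field_simp
  have hwrap_d : gapSin θ d (d + 2) = Real.sin (d * y) :=
    hwrap (zero_add _).symm _ (by omega) (by omega) (by simp)
  have hwrap_one : gapSin θ (d + 1) (d + 1 + 1) = Real.sin ((d + 1) * y) :=
    hwrap (zero_add _).symm _ (by omega) (by omega) (by simp)
  have hwrap_two : gapSin θ (d + 1) (d + 1 + 2) = Real.sin (d * y) :=
    hwrap (j := 1) (by omega) _ (by omega) (by omega) (by push_cast; ring)
  rw [edgeScale, prod_range_succ, prod_range_succ, prod_congr rfl hcos, prod_const, card_range,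
    hone le_rfl, hwrap_d, hwrap_one, hwrap_two]
  ring

theorem exists_cos_pow_mul_sin_sq_eq {d : ℕ} (hd : 2 ≤ d) {r : ℝ}
    (hr : Real.cos (Real.pi / (d + 2)) ^ (d + 2) ≤ r) :
    ∃ y ∈ Set.Ico (Real.pi / (d + 2)) (Real.pi / (d + 1)),
      Real.cos y ^ d * Real.sin (d * y) ^ 2 = r * (4 * Real.sin ((d + 1) * y) * Real.sin y) := by
  have hd' : (2 : ℝ) ≤ d := by exact_mod_cast hd
  let φ : ℝ → ℝ := fun y =>
    Real.cos y ^ d * Real.sin (d * y) ^ 2 - r * (4 * Real.sin ((d + 1) * y) * Real.sin y)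
  set z := Real.pi / ((d : ℝ) + 2) with hz
  set w := Real.pi / ((d : ℝ) + 1)
  have hzw : z ≤ w := div_le_div_of_nonneg_left Real.pi_pos.le (by linarith) (by linarith)
  have hφz : φ z ≤ 0 := by
    have hdz : d * z = Real.pi - 2 * z := by rw [hz]; field_simp; ring
    have hdz' : (d + 1) * z = Real.pi - z := by linarith
    have hφ : φ z = (Real.cos z ^ (d + 2) - r) * (4 * Real.sin z ^ 2) := by
      simp only [φ, hdz, hdz', Real.sin_pi_sub, Real.sin_two_mul]
      ring
    exact hφ.trans_le (mul_nonpos_of_nonpos_of_nonneg (sub_nonpos.2 hr) (by positivity))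
  have hφw : 0 < φ w := by
    have hdw : (d + 1) * w = Real.pi := mul_div_cancel₀ _ (by positivity)
    have hdw' : d * w = Real.pi - w := by linarith
    have hw0 : 0 < w := by positivity
    have hw2 : w < Real.pi / 2 := div_lt_div_of_pos_left Real.pi_pos two_pos (by linarith)
    have hcos : 0 < Real.cos w := Real.cos_pos_of_mem_Ioo ⟨by linarith, hw2⟩
    have hsin : 0 < Real.sin w := Real.sin_pos_of_pos_of_lt_pi hw0 (by linarith)
    simp only [φ, hdw, hdw', Real.sin_pi_sub, Real.sin_pi, mul_zero, zero_mul, sub_zero]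
    positivity
  have hφ : Continuous φ := by fun_prop
  obtain ⟨y, ⟨hzy, hyw⟩, hy⟩ := intermediate_value_Icc hzw hφ.continuousOn ⟨hφz, hφw.le⟩
  exact ⟨y, ⟨hzy, hyw.lt_of_ne fun h => hφw.ne' (h ▸ hy)⟩, sub_eq_zero.1 hy⟩

theorem exists_isCyclicAngleSeq_edgeScale_eq {d : ℕ} (hd : 2 ≤ d) {r : ℝ}
    (hr : Real.cos (Real.pi / (d + 2)) ^ (d + 2) ≤ r) :
    ∃ θ : ℕ → ℝ, IsCyclicAngleSeq (d + 2) θ ∧ edgeScale θ (d + 2) = r := by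
  obtain ⟨y, ⟨hzy, hyw⟩, hy⟩ := exists_cos_pow_mul_sin_sq_eq hd hr
  have hy0 : 0 < y := hzy.trans_lt' (by positivity)
  have hlast : (d + 1) * y < Real.pi := by rwa [lt_div_iff₀' (by positivity)] at hyw
  have hypi : y < Real.pi := hyw.trans_le (div_le_self Real.pi_pos.le (by simp))
  have hsin : 0 < Real.sin y := Real.sin_pos_of_pos_of_lt_pi hy0 hypi
  have hsin' : 0 < Real.sin ((d + 1) * y) := Real.sin_pos_of_pos_of_lt_pi (by positivity) hlast
  have hθ : IsCyclicAngleSeq (d + 2) (equalGapAngle (d + 2) y) :=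
    isCyclicAngleSeq_equalGapAngle (by omega) hy0 (by push_cast; linarith)
  exact ⟨_, hθ, by rw [edgeScale_equalGapAngle hθ, hy, mul_div_cancel_right₀ _ (by positivity)]⟩

end EqualGaps

theorem exists_isSpecialICS_scaleFactor_eq {d : ℕ} (hd : 2 ≤ d) {r : ℝ}
    (hr : Real.cos (Real.pi / (d + 2)) ^ (d + 2) ≤ r) :
    ∃ p : ℕ → EuclideanSpace ℝ (Fin d), IsSpecialICS d p ∧ scaleFactor d p = r ∧
      ∀ k, p (k + (d + 2) + 1) - p (k + (d + 2)) = -r • (p (k + 1) - p k) := by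
  obtain ⟨θ, hθ, rfl⟩ := exists_isCyclicAngleSeq_edgeScale_eq hd hr
  exact exists_isSpecialICS_of_isCyclicAngleSeq (by omega) hθ

theorem cos_pi_div_pow_le_one {x : ℝ} (hx : 2 ≤ x) (n : ℕ) : Real.cos (Real.pi / x) ^ n ≤ 1 := by
  refine pow_le_one₀ (Real.cos_nonneg_of_neg_pi_div_two_le_of_le ?_ ?_) (Real.cos_le_one _)
  · linarith [Real.pi_pos, div_nonneg Real.pi_pos.le (two_pos.le.trans hx)]
  · exact div_le_div_of_nonneg_left Real.pi_pos.le two_pos hx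

theorem mainTheorem4 (d : ℕ) (hd : 2 ≤ d) :
    (∀ r : ℝ, Real.cos (Real.pi / ((d : ℝ) + 2)) ^ (d + 2) ≤ r →
      ∃ p : ℕ → EuclideanSpace ℝ (Fin d), IsSpecialICS d p ∧ scaleFactor d p = r) ∧
    ∃ p : ℕ → EuclideanSpace ℝ (Fin d), IsICS d p ∧ IsPeriodicSeq p := by
  refine ⟨fun r hr => ?_, ?_⟩
  · obtain ⟨p, hp, hpr, -⟩ := exists_isSpecialICS_scaleFactor_eq hd hr
    exact ⟨p, hp, hpr⟩
  · have hone : Real.cos (Real.pi / ((d : ℝ) + 2)) ^ (d + 2) ≤ 1 :=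
      cos_pi_div_pow_le_one (by simp) (d + 2)
    obtain ⟨p, hp, -, hedge⟩ := exists_isSpecialICS_scaleFactor_eq hd hone
    have hperiod : Function.Periodic p (2 * (d + 2)) :=
      periodic_two_mul_of_antiperiodic_sub fun k => (hedge k).trans (neg_one_smul ℝ _)
    exact ⟨p, hp.1, 2 * (d + 2), by omega, fun k => (hperiod k).symm⟩
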